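/- \textbf{Setting.} An \emph{alternating nonzero automaton} on a finite alphabet $\Sigma$ is a tuple $\mathcal A=(Q,q_0,Q_E,Q_A,\to,F_\forall,F_1,F_{>0})$ where $Q$ is a finite totally ordered set of states, $q_0\in Q$ is the initial state, $(Q_E,Q_A)$ is a partition of $Q$ into states controlled by Eve and by Adam, $F_\forall,F_1,F_{>0}\subseteq Q$, and $\to$ is a set of \emph{local transitions} $q\to_a r$ and \emph{split transitions} $q\to_a(r_0,r_1)$ with $q,r,r_0,r_1\in Q$, $a\in\Sigma$. It is assumed to be \emph{complete}: for all $q\in Q$ and $a\in\Sigma$ there is a transition with source $q$ and letter $a$. The \emph{transition graph} on $Q$ has an edge from $q$ to $r$ whenever for some letter $a$ there is a local transition $q\to_a r$ or a split transition $q\to_a(r_0,r_1)$ with $r\in\{r_0,r_1\}$; write $q\equiv r$ if $q$ and $r$ lie in the same strongly connected component of this graph (states on no cycle lie in no component). The automaton has \emph{limited choice for Adam} if for every $q\in Q_A$ all transitions with source $q$ are local and, for every letter $a$, at most one local transition $q\to_a q'$ satisfies $q\equiv q'$. It satisfies \textbf{(NLL)} (no local loop) if there are no letter $a$ and sequence of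 local transitions $q_0\to_a q_1\to_a\cdots\to_a q_i$, $i\ge 1$, with $q_0=q_i$. \textbf{Acceptance game.} Let $t:\{0,1\}^*\to\Sigma$ be a labelled binary tree. The vertices of the acceptance game of $t$ are the pairs $(n,q)\in\{0,1\}^*\times Q$, and the initial vertex is $(\epsilon,q_0)$. At $(n,q)$ the player controlling $q$ chooses a transition with source $q$ and letter $t(n)$: after $q\to_{t(n)}r$ the next vertex is $(n,r)$; after $q\to_{t(n)}(r_0,r_1)$ it is $(n0,r_0)$ or $(n1,r_1)$, each with probability $\frac12$. A strategy of a player associates with every finite play (nonempty finite sequence of vertices) whose last vertex is controlled by that player a transition available there. Strategies $\sigma$ of Eve and $\tau$ of Adam induce a probability measure $\mathbb P^{\sigma,\tau}$ on infinite plays starting in the initial vertex. A finite play is consistent with $\sigma,\tau$ if it starts in the initial vertex and each next vertex is a possible outcome of the transition chosen by $\sigma$ or $\tau$; an infinite play is consistent if all its finite prefixes are. The \emph{limsup} of an infinite play is the largest state visited infinitely often. Eve \emph{wins with $\sigma$ against $\tau$} if (i) every infinite play consistent with $\sigma$ and $\tau$ has limsup in $F_\forall$; (ii) $\mathbb P^{\sigma,\tau}$-almost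 every play has limsup in $F_1$; (iii) for every finite play $\pi$ consistent with $\sigma$ and $\tau$ whose last state is in $F_{>0}$, the set of infinite continuations of $\pi$ all of whose states after $\pi$ belong to $F_{>0}$ has nonzero $\mathbb P^{\sigma,\tau}$-probability. A strategy $\sigma$ of Eve is \emph{winning} if she wins with $\sigma$ against every strategy $\tau$ of Adam, and \emph{positional} if $\sigma(\pi)=\sigma(\pi')$ for all finite plays $\pi,\pi'$ with the same last vertex, controlled by Eve. \textbf{Lemma (positional determinacy for Eve).} Let $\mathcal A$ be a complete alternating nonzero automaton on a finite alphabet $\Sigma$ with limited choice for Adam and satisfying (NLL), and let $t$ be a $\Sigma$-labelled binary tree. If Eve has a winning strategy in the acceptance game of $t$ by $\mathcal A$, then she has a positional winning strategy in this game. -/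

import Mathlib

/-- The two strategic players. -/
inductive NZPlayer : Type
  | eve
  | adam

/-- The target part of a transition: `stay r` is the target of a local transition `q →_a r`,
`split r₀ r₁` is the pair of targets of a split transition `q →_a (r₀, r₁)`. -/
inductive NZMove (Q : Type*) : Type _
  | stay (r : Q)
  | split (r₀ r₁ : Q)

/-- An alternating nonzero automaton with alphabet `S` and state space `Q`.
The finiteness of `Q` and its total order are type class arguments where they are used.
The partition of `Q` into Eve and Adam states is given by the controller of each state;
`trans q a` is the set of transitions with source `q` and letter `a`. -/
structure NZAutomaton (S Q : Type*) where
  /-- the initial state -/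
  init : Q
  /-- the player controlling a state -/
  owner : Q → NZPlayer
  /-- the transitions with a given source and letter -/
  trans : Q → S → Set (NZMove Q)
  /-- the surely winning states `F_∀` -/
  Fall : Set Q
  /-- the almost-surely winning states `F_1` -/
  Fone : Set Q
  /-- the positively winning states `F_{>0}` -/
  Fpos : Set Q

/-- A vertex of the acceptance game: a node of the binary tree (a word over `{0,1}`, with
`0 = false`, `1 = true`; the sons of `n` are `n ++ [false]` and `n ++ [true]`) and a state. -/
@[ext]
structure NZVertex (Q : Type*) where
  /-- the node of the binary tree -/
  node : List Bool
  /-- the state of the automaton -/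
  state : Q

/-- The set of vertices is discrete, so that the product `σ`-algebra on `ℕ → NZVertex Q`
is the one generated by the cylinders. -/
instance NZVertex.instMeasurableSpace (Q : Type*) : MeasurableSpace (NZVertex Q) := ⊤

instance NZVertex.instDiscrete (Q : Type*) : DiscreteMeasurableSpace (NZVertex Q) :=
  ⟨fun _ => trivial⟩

instance NZVertex.instCountable (Q : Type*) [Countable Q] : Countable (NZVertex Q) := by
  have h : Function.Injective (fun v : NZVertex Q => (v.node, v.state)) := by
    intro v w hvw
    simp only [Prod.mk.injEq] at hvw
    exact NZVertex.ext hvw.1 hvw.2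
  exact h.countable

namespace NZMove

variable {Q : Type*}

/-- The possible next vertices when a transition is played on the node `n`. -/
def succs (n : List Bool) : NZMove Q → Set (NZVertex Q)
  | stay r => {⟨n, r⟩}
  | split r₀ r₁ => {⟨n ++ [false], r₀⟩, ⟨n ++ [true], r₁⟩}

/-- The law of the next vertex when a transition is played on the node `n`. -/
noncomputable def law (n : List Bool) : NZMove Q → MeasureTheory.Measure (NZVertex Q)
  | stay r => MeasureTheory.Measure.dirac ⟨n, r⟩
  | split r₀ r₁ =>
      (2⁻¹ : ENNReal) • MeasureTheory.Measure.dirac ⟨n ++ [false], r₀⟩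
        + (2⁻¹ : ENNReal) • MeasureTheory.Measure.dirac ⟨n ++ [true], r₁⟩

instance instIsProbabilityMeasureLaw (n : List Bool) (m : NZMove Q) :
    MeasureTheory.IsProbabilityMeasure (m.law n) := by
  constructor
  cases m with
  | stay r => simp [law]
  | split r₀ r₁ => simp [law, ENNReal.inv_two_add_inv_two]

end NZMove

namespace NZAutomaton

variable {S Q : Type*}

/-- Completeness: every state has at least one transition on every letter. -/
def Complete (A : NZAutomaton S Q) : Prop :=
  ∀ q a, (A.trans q a).Nonempty

/-- The edges of the transition graph (with the labels forgotten). -/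
def Edge (A : NZAutomaton S Q) (q r : Q) : Prop :=
  ∃ a, NZMove.stay r ∈ A.trans q a ∨
    ∃ q', NZMove.split r q' ∈ A.trans q a ∨ NZMove.split q' r ∈ A.trans q a

/-- `q ≡ r`: the two states belong to the same (strongly) connected component of the transition
graph. A state that lies on no cycle (a transient state) belongs to no component. -/
def Equivalent (A : NZAutomaton S Q) (q r : Q) : Prop :=
  Relation.TransGen A.Edge q r ∧ Relation.TransGen A.Edge r q

/-- Limited choice for Adam: transitions of Adam are local, and for each Adam state and letter
at most one of them is canonical, i.e. stays in the component of its source. -/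
def LimitedChoice (A : NZAutomaton S Q) : Prop :=
  ∀ q, A.owner q = NZPlayer.adam → ∀ a,
    (∀ m ∈ A.trans q a, ∃ r, m = NZMove.stay r) ∧
    (∀ r r', NZMove.stay r ∈ A.trans q a → NZMove.stay r' ∈ A.trans q a →
      A.Equivalent q r → A.Equivalent q r' → r = r')

/-- No local loop: no nonempty sequence of local transitions on one letter is a cycle. -/
def NoLocalLoop (A : NZAutomaton S Q) : Prop :=
  ∀ a q, ¬ Relation.TransGen (fun p r => NZMove.stay r ∈ A.trans p a) q q

/-- The initial vertex of acceptance games. -/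
def start (A : NZAutomaton S Q) : NZVertex Q := ⟨[], A.init⟩

/-- A strategy of the player `p` in the acceptance game of the tree `t`: to every nonempty finite
sequence of vertices whose last vertex is controlled by `p` it associates a transition available
there. (The values of `move` on other sequences are irrelevant.) -/
structure Strategy (A : NZAutomaton S Q) (t : List Bool → S) (p : NZPlayer) where
  /-- the chosen transition -/
  move : List (NZVertex Q) → NZMove Q
  legal : ∀ (π : List (NZVertex Q)) (v : NZVertex Q), π.getLast? = some v →
    A.owner v.state = p → move π ∈ A.trans v.state (t v.node)

section Game

variable {A : NZAutomaton S Q} {t : List Bool → S}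

/-- A positional strategy depends only on the last vertex of the play. -/
def Strategy.Positional {p : NZPlayer} (σ : A.Strategy t p) : Prop :=
  ∀ (π π' : List (NZVertex Q)) (v : NZVertex Q),
    π.getLast? = some v → π'.getLast? = some v → A.owner v.state = p → σ.move π = σ.move π'

variable (σ : A.Strategy t NZPlayer.eve) (τ : A.Strategy t NZPlayer.adam)

/-- The transition played after the finite play `π` with last vertex `v`, by its controller. -/
def played (π : List (NZVertex Q)) (v : NZVertex Q) : NZMove Q :=
  match A.owner v.state with
  | NZPlayer.eve => σ.move π
  | NZPlayer.adam => τ.move π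

/-- The finite plays consistent with `σ` and `τ`: those that start in the initial vertex and
may occur when Eve plays `σ` and Adam plays `τ`. -/
inductive Consistent : List (NZVertex Q) → Prop
  | start : Consistent [A.start]
  | step (π : List (NZVertex Q)) (v w : NZVertex Q) : Consistent π → π.getLast? = some v →
      w ∈ (played σ τ π v).succs v.node → Consistent (π ++ [w])

/-- The list of the `n + 1` vertices with indices `0, …, n`. -/
def history (n : ℕ) (x : Finset.Iic n → NZVertex Q) : List (NZVertex Q) :=
  List.ofFn fun i : Fin (n + 1) => x ⟨i.1, Finset.mem_Iic.2 (Nat.lt_succ_iff.1 i.2)⟩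

/-- The prefix of length `n + 1` of an infinite play. -/
def prefixPlay (ρ : ℕ → NZVertex Q) (n : ℕ) : List (NZVertex Q) :=
  List.ofFn fun i : Fin (n + 1) => ρ i.1

/-- An infinite play is consistent with `σ` and `τ` if all its prefixes are. -/
def ConsistentInf (ρ : ℕ → NZVertex Q) : Prop :=
  ∀ n, Consistent σ τ (prefixPlay ρ n)

/-- The law of the vertex with index `n + 1` given those with indices `0, …, n`. -/
noncomputable def stepKernel [Countable Q] (n : ℕ) :
    ProbabilityTheory.Kernel (Finset.Iic n → NZVertex Q) (NZVertex Q) where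
  toFun x := (played σ τ (history n x) (x ⟨n, Finset.mem_Iic.2 le_rfl⟩)).law
    (x ⟨n, Finset.mem_Iic.2 le_rfl⟩).node
  measurable' := measurable_of_countable _

instance instIsMarkovKernelStepKernel [Countable Q] (n : ℕ) :
    ProbabilityTheory.IsMarkovKernel (stepKernel σ τ n) :=
  ⟨fun _ => NZMove.instIsProbabilityMeasureLaw _ _⟩

/-- The probability measure on infinite plays induced by `σ` and `τ`, given by the theorem of
Ionescu-Tulcea. -/
noncomputable def playMeasure [Countable Q] : MeasureTheory.Measure (ℕ → NZVertex Q) :=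
  ProbabilityTheory.Kernel.traj (X := fun _ => NZVertex Q) (stepKernel σ τ) 0 fun _ => A.start

/-- The limsup of the infinite play `ρ`, i.e. the largest state visited infinitely often,
belongs to `F`. -/
def LimsupIn [LinearOrder Q] (ρ : ℕ → NZVertex Q) (F : Set Q) : Prop :=
  ∃ q ∈ F, IsGreatest {r | ∃ᶠ k in Filter.atTop, (ρ k).state = r} q

/-- The positive continuations of the finite play `π`: the infinite plays with prefix `π` all
of whose states after `π` belong to `F_{>0}`. -/
def positiveContinuations (A : NZAutomaton S Q) (π : List (NZVertex Q)) :
    Set (ℕ → NZVertex Q) :=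
  {ρ | (∀ (i : ℕ) (hi : i < π.length), ρ i = π[i]) ∧
    ∀ i, π.length ≤ i → (ρ i).state ∈ A.Fpos}

/-- Eve wins with `σ` against `τ`. -/
structure WinsAgainst [Countable Q] [LinearOrder Q] : Prop where
  sure : ∀ ρ, ConsistentInf σ τ ρ → LimsupIn ρ A.Fall
  almostSure : ∀ᵐ ρ ∂playMeasure σ τ, LimsupIn ρ A.Fone
  positive : ∀ π v, Consistent σ τ π → π.getLast? = some v → v.state ∈ A.Fpos →
    playMeasure σ τ (A.positiveContinuations π) ≠ 0

/-- A winning strategy of Eve wins against all strategies of Adam. -/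
def Winning [Countable Q] [LinearOrder Q] (σ : A.Strategy t NZPlayer.eve) : Prop :=
  ∀ τ : A.Strategy t NZPlayer.adam, WinsAgainst σ τ

end Game

end NZAutomaton

/-! Let `σ` be winning for Eve. A positional strategy is obtained by fixing, for each vertex
reachable with `σ`, one history that leads to it, and playing there what `σ` plays after this
history. The histories must be chosen coherently, so that a play of the new strategy eventually
follows a single play of `σ`.

Cut a play consistent with `σ` at its last change of strongly connected component, detected by
`rank`, and call the prefix up to there its root. After the root, limited choice leaves Adam at most
one move inside the component, so two plays with the same root can separate only at a split
transition, into disjoint subtrees. Since (NLL) also forbids cycles in the arena, the root and the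
last vertex determine the play (`Thread.unique`).

Enumerate the finite plays and give each vertex the history whose root has the least index. The pair
(rank, index of the root), ordered lexicographically, never increases along a play of the new
strategy, and while it is constant the chosen histories extend one another
(`nonempty_historyChoice`). The order is well founded, so the pair is eventually constant and the
tail of every play is a tail of a play of `σ`.

Each winning condition is then transferred from `σ`, against an Adam who produces the chosen history
and afterwards imitates his opponent strategy (`exists_imitation`). The sure condition depends only
on tails. For the almost sure one, there are countably many finite plays after which the level may
have stabilised, and null sets transfer after each (`Follows.exists_measure_eq_zero_iff`). For the
positive one, first move inside `F_{>0}` to a vertex of minimal level: from there, all positive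
continuations keep the level. -/

namespace NZAutomaton

/-! ### Components, ranks and acyclicity of the arena. -/

section Arena

variable {S Q : Type*}

/-- The number of states reachable from `q`: it is constant inside a component and decreases
along the edges that leave a component. -/
noncomputable def rank (A : NZAutomaton S Q) (q : Q) : ℕ :=
  {r | Relation.ReflTransGen A.Edge q r}.ncard

theorem rank_le_of_edge [Finite Q] {A : NZAutomaton S Q} {q r : Q} (h : A.Edge q r) :
    A.rank r ≤ A.rank q :=
  Set.ncard_le_ncard fun _ hs => Relation.ReflTransGen.head h hs

/-- Along an edge the reachable sets are nested; equal finite cardinality makes them equal, so the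
source is reachable from the target. -/
theorem equivalent_of_edge_of_rank_eq [Finite Q] {A : NZAutomaton S Q} {q r : Q}
    (h : A.Edge q r) (hr : A.rank r = A.rank q) : A.Equivalent q r := by
  have hsub : {s | Relation.ReflTransGen A.Edge r s} ⊆ {s | Relation.ReflTransGen A.Edge q s} :=
    fun _ hs => Relation.ReflTransGen.head h hs
  have heq := Set.eq_of_subset_of_ncard_le hsub hr.ge
  have hq : q ∈ {s | Relation.ReflTransGen A.Edge r s} := by
    rw [heq]
    exact Relation.ReflTransGen.refl
  refine ⟨Relation.TransGen.single h, ?_⟩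
  rcases Relation.reflTransGen_iff_eq_or_transGen.1 hq with rfl | h'
  · exact Relation.TransGen.single h
  · exact h'

/-- `w` is a possible successor of the vertex `v` in the acceptance game of `t`. -/
def VertexStep (A : NZAutomaton S Q) (t : List Bool → S) (v w : NZVertex Q) : Prop :=
  ∃ m ∈ A.trans v.state (t v.node), w ∈ m.succs v.node

theorem edge_of_mem_succs {A : NZAutomaton S Q} {q : Q} {a : S} {m : NZMove Q} {n : List Bool}
    {w : NZVertex Q} (hm : m ∈ A.trans q a) (hw : w ∈ m.succs n) : A.Edge q w.state := by
  refine ⟨a, ?_⟩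
  cases m with
  | stay r =>
    obtain rfl : w = ⟨n, r⟩ := hw
    exact Or.inl hm
  | split r₀ r₁ =>
    rcases hw with rfl | hw
    · exact Or.inr ⟨r₁, Or.inl hm⟩
    · obtain rfl : w = ⟨n ++ [true], r₁⟩ := hw
      exact Or.inr ⟨r₀, Or.inr hm⟩

theorem VertexStep.edge {A : NZAutomaton S Q} {t : List Bool → S} {v w : NZVertex Q}
    (h : A.VertexStep t v w) : A.Edge v.state w.state := by
  obtain ⟨m, hm, hw⟩ := h
  exact edge_of_mem_succs hm hw

/-- A path of the arena goes strictly down the tree, or it is a local path on one node. -/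
theorem transGen_vertexStep {A : NZAutomaton S Q} {t : List Bool → S} {v w : NZVertex Q}
    (h : Relation.TransGen (A.VertexStep t) v w) :
    v.node <+: w.node ∧ (v.node = w.node →
      Relation.TransGen (fun p r => NZMove.stay r ∈ A.trans p (t v.node)) v.state w.state) := by
  have key : ∀ {u w : NZVertex Q}, A.VertexStep t u w →
      (w.node = u.node ∧ NZMove.stay w.state ∈ A.trans u.state (t u.node)) ∨
        ∃ b, w.node = u.node ++ [b] := by
    rintro u w ⟨m, hm, hw⟩
    cases m with
    | stay r =>
      obtain rfl : w = ⟨u.node, r⟩ := hw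
      exact Or.inl ⟨rfl, hm⟩
    | split r₀ r₁ =>
      rcases hw with rfl | hw
      · exact Or.inr ⟨_, rfl⟩
      · obtain rfl : w = ⟨u.node ++ [true], r₁⟩ := hw
        exact Or.inr ⟨_, rfl⟩
  induction h with
  | single h =>
    rcases key h with ⟨h₁, h₂⟩ | ⟨b, hb⟩
    · exact ⟨by rw [h₁], fun _ => Relation.TransGen.single h₂⟩
    · exact ⟨by rw [hb]; exact List.prefix_append _ _, fun h' => by simp [← h'] at hb⟩
  | tail _ h ih =>
    rcases key h with ⟨h₁, h₂⟩ | ⟨b, hb⟩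
    · refine ⟨by rw [h₁]; exact ih.1, fun h' => ?_⟩
      rw [h₁] at h'
      rw [← h'] at h₂
      exact (ih.2 h').tail h₂
    · refine ⟨by rw [hb]; exact ih.1.trans (List.prefix_append _ _), fun h' => ?_⟩
      have := ih.1.length_le
      rw [h', hb] at this
      simp at this

theorem NoLocalLoop.not_transGen_vertexStep {A : NZAutomaton S Q} (hNLL : A.NoLocalLoop)
    {t : List Bool → S} (v : NZVertex Q) : ¬ Relation.TransGen (A.VertexStep t) v v :=
  fun h => hNLL _ _ ((transGen_vertexStep h).2 rfl)

theorem prefix_node_of_reflTransGen {A : NZAutomaton S Q} {t : List Bool → S}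
    {v w : NZVertex Q} (h : Relation.ReflTransGen (A.VertexStep t) v w) : v.node <+: w.node := by
  rcases Relation.reflTransGen_iff_eq_or_transGen.1 h with rfl | h'
  · exact List.prefix_rfl
  · exact (transGen_vertexStep h').1

end Arena

/-! ### Histories with a root, their uniqueness, and the coherent choice of one per vertex. -/

section Threads

variable {S Q : Type*} {A : NZAutomaton S Q} {t : List Bool → S}

/-- `w` may follow the finite play `π` with last vertex `v` if Eve plays `σ`. -/
def EveStep (σ : A.Strategy t NZPlayer.eve) (π : List (NZVertex Q)) (v w : NZVertex Q) : Prop :=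
  ∃ m ∈ A.trans v.state (t v.node),
    (A.owner v.state = NZPlayer.eve → m = σ.move π) ∧ w ∈ m.succs v.node

theorem EveStep.vertexStep {σ : A.Strategy t NZPlayer.eve} {π : List (NZVertex Q)}
    {v w : NZVertex Q} (h : EveStep σ π v w) : A.VertexStep t v w := by
  obtain ⟨m, hm, -, hw⟩ := h
  exact ⟨m, hm, hw⟩

/-- `Thread σ ρ π`: the finite play `π` is consistent with `σ` and `ρ` is its shortest nonempty
prefix after which the rank of the states does not change any more. -/
inductive Thread (σ : A.Strategy t NZPlayer.eve) :
    List (NZVertex Q) → List (NZVertex Q) → Prop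
  | start : Thread σ [A.start] [A.start]
  | keep (ρ π : List (NZVertex Q)) (v w : NZVertex Q) : Thread σ ρ π → π.getLast? = some v →
      EveStep σ π v w → A.rank w.state = A.rank v.state → Thread σ ρ (π ++ [w])
  | drop (ρ π : List (NZVertex Q)) (v w : NZVertex Q) : Thread σ ρ π → π.getLast? = some v →
      EveStep σ π v w → A.rank w.state ≠ A.rank v.state → Thread σ (π ++ [w]) (π ++ [w])

theorem Thread.prefix {σ : A.Strategy t NZPlayer.eve} {ρ π : List (NZVertex Q)}
    (h : Thread σ ρ π) : ρ <+: π := by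
  induction h with
  | start => exact List.prefix_rfl
  | keep ρ π v w _ _ _ _ ih => exact ih.trans (List.prefix_append _ _)
  | drop => exact List.prefix_rfl

/-- With acyclicity of the arena, this prevents a proper prefix of a history from ending in the same
vertex as the history. -/
theorem Thread.reflTransGen {σ : A.Strategy t NZPlayer.eve} {ρ π : List (NZVertex Q)}
    (h : Thread σ ρ π) {v : NZVertex Q} (hv : π.getLast? = some v) {κ : List (NZVertex Q)}
    {u : NZVertex Q} (hκ : κ <+: π) (hu : κ.getLast? = some u) :
    (κ = π ∧ u = v) ∨ Relation.TransGen (A.VertexStep t) u v := by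
  have aux : ∀ {π : List (NZVertex Q)} {x y : NZVertex Q},
      (∀ {v : NZVertex Q}, π.getLast? = some v → ∀ {κ : List (NZVertex Q)} {u : NZVertex Q},
        κ <+: π → κ.getLast? = some u →
          (κ = π ∧ u = v) ∨ Relation.TransGen (A.VertexStep t) u v) →
      π.getLast? = some x → EveStep σ π x y → ∀ {v : NZVertex Q}, (π ++ [y]).getLast? = some v →
        ∀ {κ : List (NZVertex Q)} {u : NZVertex Q}, κ <+: π ++ [y] → κ.getLast? = some u →
          (κ = π ++ [y] ∧ u = v) ∨ Relation.TransGen (A.VertexStep t) u v := by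
    intro π x y ih hx hxy v hv κ u hκ hu
    obtain rfl : y = v := by simpa using hv
    rcases List.prefix_concat_iff.1 hκ with rfl | hκ
    · exact Or.inl ⟨rfl, by simpa using hu.symm⟩
    · right
      rcases ih hx hκ hu with ⟨-, rfl⟩ | h
      · exact Relation.TransGen.single hxy.vertexStep
      · exact h.tail hxy.vertexStep
  induction h generalizing v κ u with
  | start =>
    left
    have hκ' : κ = [A.start] := by
      rcases List.prefix_concat_iff (l₂ := []).1 hκ with h | h
      · exact h
      · simp [List.prefix_nil.1 h] at hu
    subst hκ'
    exact ⟨rfl, by simpa using hu.symm.trans hv⟩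
  | keep ρ π x y _ hx hxy _ ih => exact aux (fun {_} a {_ _} b c => ih a b c) hx hxy hv hκ hu
  | drop ρ π x y _ hx hxy _ ih => exact aux (fun {_} a {_ _} b c => ih a b c) hx hxy hv hκ hu

theorem Thread.eveStep_of_prefix {σ : A.Strategy t NZPlayer.eve} {ρ π : List (NZVertex Q)}
    (h : Thread σ ρ π) {κ : List (NZVertex Q)} {v w : NZVertex Q} (hρ : ρ <+: κ)
    (hκ : κ ++ [w] <+: π) (hv : κ.getLast? = some v) :
    EveStep σ κ v w ∧ A.rank w.state = A.rank v.state := by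
  induction h with
  | start =>
    have h₁ := hρ.length_le
    have h₂ := hκ.length_le
    simp only [List.length_append, List.length_singleton] at h₁ h₂
    omega
  | keep ρ π x y _ hx hxy hr ih =>
    rcases List.prefix_concat_iff.1 hκ with h | h
    · obtain ⟨rfl, h⟩ := List.append_inj' h rfl
      obtain rfl : w = y := by simpa using h
      obtain rfl : x = v := by simpa [hx] using hv
      exact ⟨hxy, hr⟩
    · exact ih hρ h
  | drop ρ π x y =>
    have h₁ := hρ.length_le
    have h₂ := hκ.length_le
    simp only [List.length_append, List.length_singleton] at h₁ h₂
    omega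

/-- Two successors of the same rank are equal or lie in disjoint subtrees. -/
theorem EveStep.eq_or_incomparable [Finite Q] (hLC : A.LimitedChoice)
    {σ : A.Strategy t NZPlayer.eve} {π : List (NZVertex Q)} {v w w' : NZVertex Q}
    (hw : EveStep σ π v w) (hw' : EveStep σ π v w')
    (hr : A.rank w.state = A.rank v.state) (hr' : A.rank w'.state = A.rank v.state) :
    w = w' ∨ (¬ w.node <+: w'.node ∧ ¬ w'.node <+: w.node) := by
  have he := equivalent_of_edge_of_rank_eq hw.vertexStep.edge hr
  have he' := equivalent_of_edge_of_rank_eq hw'.vertexStep.edge hr'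
  obtain ⟨m, hm, hmσ, hwm⟩ := hw
  obtain ⟨m', hm', hmσ', hwm'⟩ := hw'
  -- For Eve both vertices come from the one transition chosen by `σ`; for Adam, equal rank makes
  -- both local moves canonical, and limited choice identifies them.
  rcases ho : A.owner v.state with _ | _
  · obtain rfl : m = m' := (hmσ ho).trans (hmσ' ho).symm
    cases m with
    | stay r =>
      left
      have h₁ : w = ⟨v.node, r⟩ := hwm
      have h₂ : w' = ⟨v.node, r⟩ := hwm'
      rw [h₁, h₂]
    | split r₀ r₁ =>
      have h₁ : w = ⟨v.node ++ [false], r₀⟩ ∨ w = ⟨v.node ++ [true], r₁⟩ := hwm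
      have h₂ : w' = ⟨v.node ++ [false], r₀⟩ ∨ w' = ⟨v.node ++ [true], r₁⟩ := hwm'
      rcases h₁ with rfl | rfl <;> rcases h₂ with rfl | rfl <;> simp
  · obtain ⟨hloc, huniq⟩ := hLC v.state ho (t v.node)
    obtain ⟨r, rfl⟩ := hloc m hm
    obtain ⟨r', rfl⟩ := hloc m' hm'
    have h₁ : w = ⟨v.node, r⟩ := hwm
    have h₂ : w' = ⟨v.node, r'⟩ := hwm'
    subst h₁ h₂
    left
    rw [huniq r r' hm hm' he he']

/-- Two histories with a common root coincide until they first differ. There both successors keep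
the rank after the same past, so they lie in disjoint subtrees, and going down the tree preserves
this. -/
theorem Thread.comparable [Finite Q] (hLC : A.LimitedChoice) {σ : A.Strategy t NZPlayer.eve}
    {ρ π π' : List (NZVertex Q)} (h : Thread σ ρ π) (h' : Thread σ ρ π') {v v' : NZVertex Q}
    (hv : π.getLast? = some v) (hv' : π'.getLast? = some v') :
    π <+: π' ∨ π' <+: π ∨ (¬ v.node <+: v'.node ∧ ¬ v'.node <+: v.node) := by
  induction h generalizing v with
  | start => exact Or.inl h'.prefix
  | drop => exact Or.inl h'.prefix
  | keep ρ κ x w hκ hx hxw hr ih =>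
    obtain rfl : w = v := by simpa using hv
    have hnode : x.node <+: w.node :=
      prefix_node_of_reflTransGen (Relation.ReflTransGen.single hxw.vertexStep)
    rcases ih h' hx with h | h | ⟨h₁, h₂⟩
    · obtain ⟨l, rfl⟩ := h
      cases l with
      | nil =>
        right; left
        simp
      | cons w' l =>
        have hpre : κ ++ [w'] <+: κ ++ w' :: l := ⟨l, by simp⟩
        obtain ⟨hs, hr'⟩ := h'.eveStep_of_prefix hκ.prefix hpre hx
        have hdown : w'.node <+: v'.node := by
          rcases h'.reflTransGen hv' hpre (u := w') (by simp) with ⟨-, rfl⟩ | h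
          · exact List.prefix_rfl
          · exact (transGen_vertexStep h).1
        rcases hxw.eq_or_incomparable hLC hs hr hr' with rfl | ⟨h₁, h₂⟩
        · exact Or.inl hpre
        · right; right
          refine ⟨fun h => ?_, fun h => h₂ (hdown.trans h)⟩
          rcases List.prefix_or_prefix_of_prefix h hdown with h | h
          · exact h₁ h
          · exact h₂ h
    · exact Or.inr (Or.inl (h.trans (List.prefix_append _ _)))
    · right; right
      refine ⟨fun h => h₁ (hnode.trans h), fun h => ?_⟩
      rcases List.prefix_or_prefix_of_prefix h hnode with h | h
      · exact h₂ h
      · exact h₁ h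

/-- A history is determined by its root and its last vertex. -/
theorem Thread.unique [Finite Q] (hLC : A.LimitedChoice) (hNLL : A.NoLocalLoop)
    {σ : A.Strategy t NZPlayer.eve} {ρ π π' : List (NZVertex Q)} (h : Thread σ ρ π)
    (h' : Thread σ ρ π') {v : NZVertex Q} (hv : π.getLast? = some v)
    (hv' : π'.getLast? = some v) : π = π' := by
  rcases h.comparable hLC h' hv hv' with hp | hp | hp
  · rcases h'.reflTransGen hv' hp hv with ⟨rfl, -⟩ | hc
    · rfl
    · exact (hNLL.not_transGen_vertexStep v hc).elim
  · rcases h.reflTransGen hv hp hv' with ⟨rfl, -⟩ | hc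
    · rfl
    · exact (hNLL.not_transGen_vertexStep v hc).elim
  · exact (hp.1 List.prefix_rfl).elim

/-- Every step extends a thread; if the rank is kept then so is the root. -/
theorem Thread.extend {σ : A.Strategy t NZPlayer.eve} {ρ π : List (NZVertex Q)}
    (h : Thread σ ρ π) {v w : NZVertex Q} (hv : π.getLast? = some v) (hw : EveStep σ π v w) :
    ∃ ρ', Thread σ ρ' (π ++ [w]) ∧ (A.rank w.state = A.rank v.state → ρ' = ρ) := by
  by_cases hr : A.rank w.state = A.rank v.state
  · exact ⟨ρ, Thread.keep ρ π v w h hv hw hr, fun _ => rfl⟩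
  · exact ⟨_, Thread.drop ρ π v w h hv hw hr, fun h' => (hr h').elim⟩

/-- The choice of one history for each vertex that is reachable with `σ`, together with a
ranking of the vertices that does not increase if Eve plays according to the chosen histories,
and that decreases when the chosen history of the next vertex is not the extension of the
chosen history of the present one. -/
structure HistoryChoice (σ : A.Strategy t NZPlayer.eve) where
  /-- the vertices with a chosen history -/
  domain : Set (NZVertex Q)
  /-- the chosen history -/
  hist : NZVertex Q → List (NZVertex Q)
  /-- the ranking -/
  level : NZVertex Q → ℕ ×ₗ ℕ
  start_mem : A.start ∈ domain
  exists_thread : ∀ v ∈ domain, ∃ ρ, Thread σ ρ (hist v)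
  getLast?_hist : ∀ v ∈ domain, (hist v).getLast? = some v
  mem_of_step : ∀ v ∈ domain, ∀ w, EveStep σ (hist v) v w → w ∈ domain
  level_le : ∀ v ∈ domain, ∀ w, EveStep σ (hist v) v w → level w ≤ level v
  hist_eq : ∀ v ∈ domain, ∀ w, EveStep σ (hist v) v w → level w = level v →
    hist w = hist v ++ [w]

/-- If a step keeps the rank, the root of the present history is also a candidate for the next
vertex, so the least index cannot grow. If it stays the same, both histories have the same root and
uniqueness applies. -/
theorem nonempty_historyChoice [Finite Q] (hLC : A.LimitedChoice) (hNLL : A.NoLocalLoop)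
    (σ : A.Strategy t NZPlayer.eve) : Nonempty (HistoryChoice σ) := by
  classical
  have := Finite.to_countable (α := Q)
  -- The enumeration of all finite plays in which roots are compared.
  obtain ⟨code, hcode⟩ := exists_injective_nat (List (NZVertex Q))
  let R : Set (NZVertex Q) := {v | ∃ p : List (NZVertex Q) × List (NZVertex Q),
    Thread σ p.1 p.2 ∧ p.2.getLast? = some v}
  have hmin : ∀ v, ∃ p : List (NZVertex Q) × List (NZVertex Q), v ∈ R →
      (Thread σ p.1 p.2 ∧ p.2.getLast? = some v ∧
        ∀ ρ π, Thread σ ρ π → π.getLast? = some v → code p.1 ≤ code ρ) := by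
    intro v
    by_cases hv : v ∈ R
    · obtain ⟨p, hp, hle⟩ := WellFounded.has_min
        (measure fun p : List (NZVertex Q) × List (NZVertex Q) => code p.1).wf
        {p | Thread σ p.1 p.2 ∧ p.2.getLast? = some v} hv
      exact ⟨p, fun _ => ⟨hp.1, hp.2, fun ρ π h₁ h₂ => not_lt.1 (hle (ρ, π) ⟨h₁, h₂⟩)⟩⟩
    · exact ⟨([], []), fun h => (hv h).elim⟩
  choose p hp using hmin
  have key : ∀ v ∈ R, ∀ w, EveStep σ (p v).2 v w → w ∈ R ∧
      (toLex (A.rank w.state, code (p w).1) : ℕ ×ₗ ℕ) ≤ toLex (A.rank v.state, code (p v).1) ∧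
      ((toLex (A.rank w.state, code (p w).1) : ℕ ×ₗ ℕ) = toLex (A.rank v.state, code (p v).1) →
        (p w).2 = (p v).2 ++ [w]) := by
    intro v hv w hw
    obtain ⟨hth, hlast, -⟩ := hp v hv
    obtain ⟨ρ, hρ, hroot⟩ := hth.extend hlast hw
    have hwR : w ∈ R := ⟨(ρ, (p v).2 ++ [w]), hρ, by simp⟩
    obtain ⟨hth', hlast', hle'⟩ := hp w hwR
    have hcle := hle' _ _ hρ (by simp)
    have hrank := rank_le_of_edge hw.vertexStep.edge
    refine ⟨hwR, ?_, ?_⟩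
    · rw [Prod.Lex.toLex_le_toLex]
      rcases hrank.lt_or_eq with hlt | heq
      · exact Or.inl hlt
      · right
        rw [hroot heq] at hcle
        exact ⟨heq, hcle⟩
    · intro heq
      have heq' := toLex.injective heq
      simp only [Prod.mk.injEq] at heq'
      have hroot' := hroot heq'.1
      have : (p w).1 = ρ := by rw [hroot', hcode heq'.2]
      rw [this] at hth'
      exact hth'.unique hLC hNLL hρ hlast' (by simp)
  exact ⟨⟨R, fun v => (p v).2, fun v => toLex (A.rank v.state, code (p v).1),
    ⟨([A.start], [A.start]), Thread.start, by simp⟩, fun v hv => ⟨_, (hp v hv).1⟩,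
    fun v hv => (hp v hv).2.1, fun v hv w hw => (key v hv w hw).1,
    fun v hv w hw => (key v hv w hw).2.1, fun v hv w hw => (key v hv w hw).2.2⟩⟩

end Threads

/-! ### Measures on infinite words compared through cylinders. -/

section Words

open MeasureTheory

variable {V : Type*}

/-- The infinite sequences with prefix `s`. -/
def wordCylinder (s : List V) : Set (ℕ → V) :=
  {ρ | ∀ (i : ℕ) (hi : i < s.length), ρ i = s[i]}

/-- The prefix of length `n` of an infinite sequence. -/
def wordPrefix (n : ℕ) (ρ : ℕ → V) : List V :=
  List.ofFn fun i : Fin n => ρ i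

theorem length_wordPrefix (n : ℕ) (ρ : ℕ → V) : (wordPrefix n ρ).length = n := by
  simp [wordPrefix]

theorem mem_wordCylinder_iff {s : List V} {ρ : ℕ → V} :
    ρ ∈ wordCylinder s ↔ wordPrefix s.length ρ = s := by
  constructor
  · intro h
    refine List.ext_getElem (length_wordPrefix _ _) fun i h₁ h₂ => ?_
    simp [wordPrefix, h i h₂]
  · intro h i hi
    have : (wordPrefix s.length ρ)[i]'(by rwa [length_wordPrefix]) = s[i] := by
      simp only [h]
    simpa [wordPrefix] using this

theorem take_wordPrefix {n m : ℕ} (h : n ≤ m) (ρ : ℕ → V) :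
    (wordPrefix m ρ).take n = wordPrefix n ρ := by
  refine List.ext_getElem (by simp [length_wordPrefix, h]) fun i h₁ h₂ => ?_
  simp [wordPrefix]

theorem wordPrefix_succ (n : ℕ) (ρ : ℕ → V) :
    wordPrefix (n + 1) ρ = wordPrefix n ρ ++ [ρ n] := by
  rw [wordPrefix, List.ofFn_succ_last]
  rfl

theorem wordPrefix_add (n m : ℕ) (ρ : ℕ → V) :
    wordPrefix (n + m) ρ = wordPrefix n ρ ++ wordPrefix m (fun i => ρ (n + i)) := by
  induction m with
  | zero => simp [wordPrefix]
  | succ m ih => rw [← add_assoc, wordPrefix_succ, wordPrefix_succ, ih, List.append_assoc]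

theorem mem_wordCylinder_append {s u : List V} {ρ : ℕ → V} :
    ρ ∈ wordCylinder (s ++ u) ↔
      ρ ∈ wordCylinder s ∧ (fun i => ρ (s.length + i)) ∈ wordCylinder u := by
  rw [mem_wordCylinder_iff, mem_wordCylinder_iff, mem_wordCylinder_iff, List.length_append,
    wordPrefix_add]
  constructor
  · intro h
    exact List.append_inj h (length_wordPrefix _ _)
  · rintro ⟨h₁, h₂⟩
    rw [h₁, h₂]

theorem setOf_wordPrefix_mem_eq (n : ℕ) (D : Set (List V)) :
    {ρ : ℕ → V | wordPrefix n ρ ∈ D} = ⋃ s ∈ {s | s ∈ D ∧ s.length = n}, wordCylinder s := by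
  ext ρ
  simp only [Set.mem_ofPred_eq, Set.mem_iUnion, exists_prop, mem_wordCylinder_iff]
  constructor
  · intro h
    exact ⟨_, ⟨h, length_wordPrefix _ _⟩, by rw [length_wordPrefix]⟩
  · rintro ⟨s, ⟨hs, rfl⟩, h⟩
    rwa [h]

variable [MeasurableSpace V] [DiscreteMeasurableSpace V]

theorem measurableSet_wordCylinder (s : List V) : MeasurableSet (wordCylinder s) := by
  have : wordCylinder s = ⋂ (i : ℕ), ⋂ (hi : i < s.length), (fun ρ : ℕ → V => ρ i) ⁻¹' {s[i]} := by
    ext ρ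
    simp [wordCylinder]
  rw [this]
  exact MeasurableSet.iInter fun i => MeasurableSet.iInter fun hi =>
    measurable_pi_apply i (MeasurableSet.of_discrete)

variable [Countable V]

theorem measurableSet_wordPrefix_mem (n : ℕ) (D : Set (List V)) :
    MeasurableSet {ρ : ℕ → V | wordPrefix n ρ ∈ D} := by
  rw [setOf_wordPrefix_mem_eq]
  exact MeasurableSet.biUnion (Set.to_countable _) fun s _ => measurableSet_wordCylinder s

theorem measure_wordPrefix_mem_eq {μ ν : Measure (ℕ → V)} {D : Set (List V)}
    (h : ∀ s ∈ D, μ (wordCylinder s) = ν (wordCylinder s)) (n : ℕ) :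
    μ {ρ | wordPrefix n ρ ∈ D} = ν {ρ | wordPrefix n ρ ∈ D} := by
  have hd : ({s : List V | s ∈ D ∧ s.length = n}).PairwiseDisjoint wordCylinder := by
    intro s hs s' hs' hne
    refine Set.disjoint_left.2 fun ρ h₁ h₂ => hne ?_
    rw [mem_wordCylinder_iff, hs.2] at h₁
    rw [mem_wordCylinder_iff, hs'.2] at h₂
    exact h₁.symm.trans h₂
  rw [setOf_wordPrefix_mem_eq, measure_biUnion (Set.to_countable _) hd
    fun s _ => measurableSet_wordCylinder s, measure_biUnion (Set.to_countable _) hd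
    fun s _ => measurableSet_wordCylinder s]
  exact tsum_congr fun s => h s s.2.1

/-- Two finite measures that agree on the cylinders of the words of a prefix-closed set `G` agree
on the sequences all of whose prefixes belong to `G`. -/
theorem restrict_eq_of_wordCylinder {μ ν : Measure (ℕ → V)} [IsFiniteMeasure μ]
    [IsFiniteMeasure ν] {G : Set (List V)} (hG : ∀ s ∈ G, ∀ n, s.take n ∈ G)
    (h : ∀ s ∈ G, μ (wordCylinder s) = ν (wordCylinder s)) :
    μ.restrict {ρ | ∀ n, wordPrefix n ρ ∈ G} = ν.restrict {ρ | ∀ n, wordPrefix n ρ ∈ G} := by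
  have hdet : ∀ (n : ℕ) (D : Set (List V)),
      μ ({ρ | wordPrefix n ρ ∈ D} ∩ {ρ | ∀ n, wordPrefix n ρ ∈ G}) =
        ν ({ρ | wordPrefix n ρ ∈ D} ∩ {ρ | ∀ n, wordPrefix n ρ ∈ G}) := by
    intro n D
    -- Conditions on longer and longer prefixes decrease to the closed set defined by `G`;
    -- continuity from above passes the equality to the limit.
    let C : ℕ → Set (ℕ → V) := fun m =>
      {ρ | wordPrefix (n + m) ρ ∈ {s | s.take n ∈ D} ∩ G}
    have hC : {ρ | wordPrefix n ρ ∈ D} ∩ {ρ | ∀ n, wordPrefix n ρ ∈ G} = ⋂ m, C m := by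
      ext ρ
      simp only [Set.mem_inter_iff, Set.mem_ofPred_eq, Set.mem_iInter, C,
        take_wordPrefix (Nat.le_add_right n _)]
      constructor
      · rintro ⟨h₁, h₂⟩ m
        exact ⟨h₁, h₂ _⟩
      · intro h'
        refine ⟨(h' 0).1, fun m => ?_⟩
        have := hG _ (h' m).2 m
        rwa [take_wordPrefix (Nat.le_add_left m n)] at this
    have hanti : Antitone C := by
      intro m m' hm ρ hρ
      simp only [Set.mem_inter_iff, Set.mem_ofPred_eq, C,
        take_wordPrefix (Nat.le_add_right n _)] at hρ ⊢
      refine ⟨hρ.1, ?_⟩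
      have := hG _ hρ.2 (n + m)
      rwa [take_wordPrefix (Nat.add_le_add_left hm n)] at this
    have hmeas : ∀ m, NullMeasurableSet (C m) μ := fun m =>
      (measurableSet_wordPrefix_mem _ _).nullMeasurableSet
    have hmeas' : ∀ m, NullMeasurableSet (C m) ν := fun m =>
      (measurableSet_wordPrefix_mem _ _).nullMeasurableSet
    have h₁ := tendsto_measure_iInter_atTop hmeas hanti ⟨0, measure_ne_top μ _⟩
    have h₂ := tendsto_measure_iInter_atTop hmeas' hanti ⟨0, measure_ne_top ν _⟩
    have heq : (μ ∘ C) = (ν ∘ C) := by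
      funext m
      exact measure_wordPrefix_mem_eq (fun s hs => h s hs.2) _
    rw [heq] at h₁
    rw [hC]
    exact tendsto_nhds_unique h₁ h₂
  have huniv : ∀ κ : Measure (ℕ → V), κ.restrict {ρ | ∀ n, wordPrefix n ρ ∈ G} Set.univ =
      κ ({ρ | wordPrefix 0 ρ ∈ Set.univ} ∩ {ρ | ∀ n, wordPrefix n ρ ∈ G}) := by
    intro κ
    simp
  refine ext_of_generate_finite (measurableCylinders fun _ => V)
    generateFrom_measurableCylinders.symm isPiSystem_measurableCylinders (fun B hB => ?_) ?_
  · obtain ⟨I, T, hT, rfl⟩ := (mem_measurableCylinders _).1 hB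
    have hmB : MeasurableSet (cylinder I T : Set (ℕ → V)) := hT.cylinder I
    -- A measurable cylinder depends only on the coordinates up to the largest index in `I`, hence
    -- on one prefix.
    have hBn : (cylinder I T : Set (ℕ → V)) = {ρ | wordPrefix (I.sup id + 1) ρ ∈
        {s | ∃ ρ' ∈ (cylinder I T : Set (ℕ → V)), wordPrefix (I.sup id + 1) ρ' = s}} := by
      ext ρ
      refine ⟨fun hρ => ⟨ρ, hρ, rfl⟩, ?_⟩
      rintro ⟨ρ', hρ', heq⟩
      rw [mem_cylinder] at hρ' ⊢
      convert hρ' using 1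
      ext i
      have hi : (i : ℕ) < I.sup id + 1 := Nat.lt_succ_of_le (Finset.le_sup (f := id) i.2)
      have := congrFun (List.ofFn_injective heq) ⟨i, hi⟩
      exact this.symm
    rw [Measure.restrict_apply hmB, Measure.restrict_apply hmB, hBn]
    exact hdet _ _
  · rw [huniv, huniv]
    exact hdet _ _

/-- A version of `restrict_eq_of_wordCylinder` for the continuations of two words. -/
theorem measure_continuations_eq {μ ν : Measure (ℕ → V)} [IsFiniteMeasure μ]
    [IsFiniteMeasure ν] {G : Set (List V)} (hG : ∀ s ∈ G, ∀ n, s.take n ∈ G)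
    {p q : List V} {a b : ENNReal} (ha : a ≠ ⊤) (hb : b ≠ ⊤)
    (h : ∀ s ∈ G, a * μ (wordCylinder (p ++ s)) = b * ν (wordCylinder (q ++ s)))
    {E : Set (ℕ → V)} (hE : MeasurableSet E) (hEG : ∀ ρ ∈ E, ∀ n, wordPrefix n ρ ∈ G) :
    a * μ (wordCylinder p ∩ {ρ | (fun i => ρ (p.length + i)) ∈ E}) =
      b * ν (wordCylinder q ∩ {ρ | (fun i => ρ (q.length + i)) ∈ E}) := by
  have hshift : ∀ k : ℕ, Measurable fun (ρ : ℕ → V) (i : ℕ) => ρ (k + i) := fun k =>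
    measurable_pi_lambda _ fun i => measurable_pi_apply _
  -- The law of the continuation after `w`, unnormalised and scaled by `c`.
  let M : ENNReal → Measure (ℕ → V) → List V → Measure (ℕ → V) := fun c κ w =>
    c • (κ.restrict (wordCylinder w)).map fun ρ i => ρ (w.length + i)
  have hM : ∀ (c : ENNReal) (κ : Measure (ℕ → V)) (w : List V) {B : Set (ℕ → V)},
      MeasurableSet B →
        M c κ w B = c * κ (wordCylinder w ∩ {ρ | (fun i => ρ (w.length + i)) ∈ B}) := by
    intro c κ w B hB
    simp only [M, Measure.smul_apply, smul_eq_mul]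
    rw [Measure.map_apply (hshift _) hB, Measure.restrict_apply (hshift _ hB), Set.inter_comm]
    rfl
  have hcyl : ∀ (c : ENNReal) (κ : Measure (ℕ → V)) (w s : List V),
      M c κ w (wordCylinder s) = c * κ (wordCylinder (w ++ s)) := by
    intro c κ w s
    rw [hM _ _ _ (measurableSet_wordCylinder s)]
    congr 2
    ext ρ
    exact mem_wordCylinder_append.symm
  have hfin : ∀ (c : ENNReal) (κ : Measure (ℕ → V)) (w : List V) [IsFiniteMeasure κ],
      c ≠ ⊤ → IsFiniteMeasure (M c κ w) := by
    intro c κ w _ hc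
    refine ⟨?_⟩
    rw [hM _ _ _ MeasurableSet.univ]
    exact ENNReal.mul_lt_top hc.lt_top (measure_lt_top _ _)
  have := hfin a μ p ha
  have := hfin b ν q hb
  have key := restrict_eq_of_wordCylinder (μ := M a μ p) (ν := M b ν q) hG
    fun s hs => by rw [hcyl, hcyl, h s hs]
  have hEK : E ∩ {ρ | ∀ n, wordPrefix n ρ ∈ G} = E :=
    Set.inter_eq_left.2 fun ρ hρ => hEG ρ hρ
  have := congrArg (fun κ => κ E) key
  simp only [Measure.restrict_apply hE, hEK] at this
  rwa [hM _ _ _ hE, hM _ _ _ hE] at this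

end Words

/-! ### Cylinder probabilities in the acceptance game. -/

section PlayMeasure

open MeasureTheory ProbabilityTheory

theorem wordPrefix_succ_eq_prefixPlay {Q : Type*} (ρ : ℕ → NZVertex Q) (n : ℕ) :
    wordPrefix (n + 1) ρ = prefixPlay ρ n := rfl

theorem law_singleton_ne_zero_iff {Q : Type*} {n : List Bool} {m : NZMove Q} {w : NZVertex Q} :
    m.law n {w} ≠ 0 ↔ w ∈ m.succs n := by
  cases m with
  | stay r =>
    simp only [NZMove.law, NZMove.succs, Set.mem_singleton_iff]
    by_cases h : w = ⟨n, r⟩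
    · simp [h]
    · simp [h, Ne.symm h]
  | split r₀ r₁ =>
    simp only [NZMove.law, NZMove.succs, Measure.add_apply, Measure.smul_apply, smul_eq_mul,
      Set.mem_insert_iff, Set.mem_singleton_iff]
    by_cases h₀ : w = ⟨n ++ [false], r₀⟩
    · simp [h₀]
    · by_cases h₁ : w = ⟨n ++ [true], r₁⟩
      · simp [h₁]
      · simp [h₀, h₁, Ne.symm h₀, Ne.symm h₁]

variable {S Q : Type*} [Countable Q] {A : NZAutomaton S Q} {t : List Bool → S}

instance instIsProbabilityMeasurePlayMeasure (σ : A.Strategy t NZPlayer.eve)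
    (τ : A.Strategy t NZPlayer.adam) : IsProbabilityMeasure (playMeasure σ τ) := by
  rw [playMeasure]
  infer_instance

theorem playMeasure_wordCylinder_start (σ : A.Strategy t NZPlayer.eve)
    (τ : A.Strategy t NZPlayer.adam) : playMeasure σ τ (wordCylinder [A.start]) = 1 := by
  have h := Kernel.traj_map_frestrictLe_apply (X := fun _ => NZVertex Q)
    (κ := stepKernel σ τ) 0 0 (fun _ => A.start)
  have hcyl : wordCylinder [A.start] = Preorder.frestrictLe (π := fun _ => NZVertex Q) 0 ⁻¹'
      {fun _ => A.start} := by
    ext ρ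
    simp only [Set.mem_preimage, Set.mem_singleton_iff, mem_wordCylinder_iff]
    constructor
    · intro h'
      ext i : 1
      obtain ⟨i, hi⟩ := i
      obtain rfl : i = 0 := by simpa using hi
      simpa [wordPrefix] using h'
    · intro h'
      have := congrFun h' ⟨0, by simp⟩
      simpa [wordPrefix] using this
  rw [hcyl, playMeasure, ← Measure.map_apply (by fun_prop) (MeasurableSet.singleton _), h,
    Kernel.partialTraj_self, Kernel.id_apply]
  simp

/-- The joint law of an initial segment and the next vertex is the composition-product with
`stepKernel`, evaluated here on a product of singletons. -/
theorem playMeasure_wordCylinder_append (σ : A.Strategy t NZPlayer.eve)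
    (τ : A.Strategy t NZPlayer.adam) {π : List (NZVertex Q)} {v : NZVertex Q}
    (hv : π.getLast? = some v) (w : NZVertex Q) :
    playMeasure σ τ (wordCylinder (π ++ [w])) =
      playMeasure σ τ (wordCylinder π) * (played σ τ π v).law v.node {w} := by
  obtain ⟨n, hn⟩ : ∃ n, π.length = n + 1 :=
    ⟨π.length - 1, by
      have : π ≠ [] := by rintro rfl; simp at hv
      have := List.length_pos_iff.2 this
      omega⟩
  let x : Finset.Iic n → NZVertex Q := fun i =>
    π[i.1]'(by have := Finset.mem_Iic.1 i.2; omega)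
  have hx : history n x = π :=
    List.ext_getElem (by simp [history, hn]) fun i h₁ h₂ => by
      simp only [history, List.getElem_ofFn, x]
  have hxv : x ⟨n, Finset.mem_Iic.2 le_rfl⟩ = v := by
    rw [List.getLast?_eq_getElem?, hn] at hv
    simpa [x, hn] using hv
  have hcyl : wordCylinder π = Preorder.frestrictLe (π := fun _ => NZVertex Q) n ⁻¹' {x} := by
    ext ρ
    simp only [Set.mem_preimage, Set.mem_singleton_iff]
    constructor
    · intro h
      ext i : 1
      exact h _ _
    · intro h i hi
      exact congrFun h ⟨i, Finset.mem_Iic.2 (by omega)⟩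
  have hcyl' : wordCylinder (π ++ [w]) =
      (fun ρ : ℕ → NZVertex Q => (Preorder.frestrictLe (π := fun _ => NZVertex Q) n ρ,
        ρ (n + 1))) ⁻¹' ({x} ×ˢ {w}) := by
    ext ρ
    rw [mem_wordCylinder_append, hcyl]
    simp [wordCylinder, hn]
  have hker : stepKernel σ τ n x = (played σ τ π v).law v.node := by
    have : stepKernel σ τ n x = (played σ τ (history n x) (x ⟨n, Finset.mem_Iic.2 le_rfl⟩)).law
      (x ⟨n, Finset.mem_Iic.2 le_rfl⟩).node := rfl
    rw [this, hx, hxv]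
  have h := Kernel.partialTraj_compProd_eq_map_traj (X := fun _ => NZVertex Q)
    (κ := stepKernel σ τ) (Nat.zero_le n) (x₀ := fun _ => A.start)
  have h' := Kernel.traj_map_frestrictLe_apply (X := fun _ => NZVertex Q)
    (κ := stepKernel σ τ) 0 n (fun _ => A.start)
  rw [hcyl', hcyl, playMeasure, ← Measure.map_apply (by fun_prop) (MeasurableSet.singleton _), h',
    ← Measure.map_apply (by fun_prop)
      ((MeasurableSet.singleton _).prod (MeasurableSet.singleton _)), ← h,
    Measure.compProd_apply_prod (MeasurableSet.singleton _) (MeasurableSet.singleton _),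
    Measure.restrict_singleton, lintegral_smul_measure, lintegral_dirac, hker, smul_eq_mul]

/-- The consistent finite plays are the words, extending the initial one, whose cylinder has
positive probability. -/
theorem playMeasure_wordCylinder_ne_zero {σ : A.Strategy t NZPlayer.eve}
    {τ : A.Strategy t NZPlayer.adam} {π : List (NZVertex Q)} (h : Consistent σ τ π) :
    playMeasure σ τ (wordCylinder π) ≠ 0 := by
  induction h with
  | start => simp [playMeasure_wordCylinder_start]
  | step π v w _ hv hw ih =>
    rw [playMeasure_wordCylinder_append σ τ hv]
    exact mul_ne_zero ih (law_singleton_ne_zero_iff.2 hw)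

theorem playMeasure_wordCylinder_append_eq_zero {σ : A.Strategy t NZPlayer.eve}
    {τ : A.Strategy t NZPlayer.adam} {π : List (NZVertex Q)} {w : NZVertex Q}
    (hπ : Consistent σ τ π) (h : ¬ Consistent σ τ (π ++ [w])) :
    playMeasure σ τ (wordCylinder (π ++ [w])) = 0 := by
  obtain ⟨v, hv⟩ : ∃ v, π.getLast? = some v := by
    cases hπ <;> simp
  rw [playMeasure_wordCylinder_append σ τ hv]
  by_cases hw : w ∈ (played σ τ π v).succs v.node
  · exact (h (hπ.step π v w hv hw)).elim
  · rw [not_not.1 (mt law_singleton_ne_zero_iff.1 hw), mul_zero]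

/-- Almost every play is consistent. -/
theorem ae_consistentInf (σ : A.Strategy t NZPlayer.eve) (τ : A.Strategy t NZPlayer.adam) :
    ∀ᵐ ρ ∂playMeasure σ τ, ConsistentInf σ τ ρ := by
  have h₀ : ∀ᵐ ρ ∂playMeasure σ τ, ρ ∈ wordCylinder [A.start] :=
    (prob_compl_eq_zero_iff (measurableSet_wordCylinder [A.start])).2
      (playMeasure_wordCylinder_start σ τ)
  have h₁ : ∀ᵐ ρ ∂playMeasure σ τ, ∀ π : List (NZVertex Q), ∀ w, Consistent σ τ π →
      ¬ Consistent σ τ (π ++ [w]) → ρ ∉ wordCylinder (π ++ [w]) := by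
    rw [ae_all_iff]
    intro π
    rw [ae_all_iff]
    intro w
    by_cases hπ : Consistent σ τ π
    · by_cases hw : Consistent σ τ (π ++ [w])
      · simp [hw]
      · have := playMeasure_wordCylinder_append_eq_zero hπ hw
        filter_upwards [measure_eq_zero_iff_ae_notMem.1 this] with ρ hρ _ _
        exact hρ
    · simp [hπ]
  filter_upwards [h₀, h₁] with ρ hρ₀ hρ₁ n
  induction n with
  | zero =>
    have := mem_wordCylinder_iff.1 hρ₀
    rw [← wordPrefix_succ_eq_prefixPlay]
    have h' : wordPrefix (0 + 1) ρ = [A.start] := this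
    rw [h']
    exact Consistent.start
  | succ n ih =>
    rw [← wordPrefix_succ_eq_prefixPlay] at ih ⊢
    by_contra hcon
    rw [wordPrefix_succ] at hcon
    refine hρ₁ _ _ ih hcon ?_
    rw [← wordPrefix_succ, mem_wordCylinder_iff, length_wordPrefix]

end PlayMeasure

/-! ### The positional strategy, its plays, and imitation by Adam. -/

section Plays

variable {S Q : Type*} {A : NZAutomaton S Q} {t : List Bool → S}

theorem Consistent.of_concat {σ : A.Strategy t NZPlayer.eve} {τ : A.Strategy t NZPlayer.adam}
    {π : List (NZVertex Q)} {v w : NZVertex Q} (h : Consistent σ τ (π ++ [w]))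
    (hv : π.getLast? = some v) :
    Consistent σ τ π ∧ w ∈ (played σ τ π v).succs v.node := by
  generalize hκ : π ++ [w] = κ at h
  cases h with
  | start =>
    have : π = [] := by
      have := congrArg List.length hκ
      simpa using this
    simp [this] at hv
  | step π' v' w' hπ' hv' hw' =>
    obtain ⟨rfl, h⟩ := List.append_inj' hκ rfl
    obtain rfl : w = w' := by simpa using h
    obtain rfl : v = v' := by simpa [hv] using hv'
    exact ⟨hπ', hw'⟩

theorem Consistent.of_append {σ : A.Strategy t NZPlayer.eve} {τ : A.Strategy t NZPlayer.adam}
    {π s : List (NZVertex Q)} (h : Consistent σ τ (π ++ s)) (hπ : π ≠ []) :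
    Consistent σ τ π := by
  induction s using List.reverseRecOn with
  | nil => simpa using h
  | append_singleton s w ih =>
    rw [← List.append_assoc] at h
    have hne : π ++ s ≠ [] := by simp [hπ]
    exact ih (h.of_concat (List.getLast?_eq_some_getLast hne)).1

theorem getLast?_append_of_eq {α : Type*} {π π' : List α} (h : π.getLast? = π'.getLast?)
    (s : List α) : (π ++ s).getLast? = (π' ++ s).getLast? := by
  simp [List.getLast?_append, h]

/-- Adam can play so that a given history may occur, and then imitate `τ`. -/
theorem exists_imitation {σ : A.Strategy t NZPlayer.eve} (τ : A.Strategy t NZPlayer.adam)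
    (hHC : A.Complete) {ρ π κ : List (NZVertex Q)} (hκ : Thread σ ρ κ)
    (hlast : π.getLast? = κ.getLast?) :
    ∃ τ' : A.Strategy t NZPlayer.adam, Consistent σ τ' κ ∧
      ∀ s, τ'.move (κ ++ s) = τ.move (π ++ s) := by
  classical
  -- Two regimes: beyond `κ`, copy `τ` with `κ` replaced by `π`; before `κ` is completed, allow its
  -- next vertex.
  have hex : ∀ l : List (NZVertex Q), ∃ m : NZMove Q,
      (∀ s, l = κ ++ s → m = τ.move (π ++ s)) ∧ (¬ κ <+: l → ∀ v, l.getLast? = some v →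
        m ∈ A.trans v.state (t v.node) ∧
          ∀ w, l ++ [w] <+: κ → A.VertexStep t v w → w ∈ m.succs v.node) := by
    intro l
    by_cases hl : κ <+: l
    · obtain ⟨s, rfl⟩ := hl
      exact ⟨τ.move (π ++ s), fun s' hs' => by rw [List.append_cancel_left hs'],
        fun h => (h (List.prefix_append _ _)).elim⟩
    · have hl' : ∀ s, l = κ ++ s → False := fun s hs => hl ⟨s, hs.symm⟩
      cases hv : l.getLast? with
      | none => exact ⟨τ.move [], fun s hs => (hl' s hs).elim, fun _ v hv' => by simp at hv'⟩
      | some v =>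
        by_cases hw : ∃ w, l ++ [w] <+: κ ∧ A.VertexStep t v w
        · obtain ⟨w, hw, m, hm, hwm⟩ := hw
          refine ⟨m, fun s hs => (hl' s hs).elim, fun _ v' hv' => ?_⟩
          obtain rfl : v = v' := by simpa using hv'
          refine ⟨hm, fun w' hw' _ => ?_⟩
          have := List.prefix_of_prefix_length_le hw hw' (by simp)
          obtain rfl : w = w' := by simpa using this.eq_of_length (by simp)
          exact hwm
        · obtain ⟨m, hm⟩ := hHC v.state (t v.node)
          refine ⟨m, fun s hs => (hl' s hs).elim, fun _ v' hv' => ?_⟩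
          obtain rfl : v = v' := by simpa using hv'
          exact ⟨hm, fun w' h₁ h₂ => (hw ⟨w', h₁, h₂⟩).elim⟩
  choose f hf hf' using hex
  let τ' : A.Strategy t NZPlayer.adam :=
    { move := f
      legal := by
        intro l v hv ho
        by_cases hl : κ <+: l
        · obtain ⟨s, rfl⟩ := hl
          rw [hf _ s rfl]
          -- The copied move is legal because `π` and `κ` end in the same vertex.
          exact τ.legal _ _ (by rw [getLast?_append_of_eq hlast, hv]) ho
        · exact (hf' l hl v hv).1 }
  have hcons : ∀ {ρ l : List (NZVertex Q)}, Thread σ ρ l → l <+: κ → Consistent σ τ' l := by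
    have aux : ∀ {l : List (NZVertex Q)} {v w : NZVertex Q}, (l <+: κ → Consistent σ τ' l) →
        l.getLast? = some v → EveStep σ l v w → l ++ [w] <+: κ →
          Consistent σ τ' (l ++ [w]) := by
      intro l v w ih hv hw hpre
      refine (ih ((List.prefix_append _ _).trans hpre)).step l v w hv ?_
      cases ho : A.owner v.state with
      | eve =>
        obtain ⟨m, -, hm, hwm⟩ := hw
        rw [hm ho] at hwm
        simpa [played, ho] using hwm
      | adam =>
        have hnot : ¬ κ <+: l := fun h => by
          have h₁ := h.length_le
          have h₂ := hpre.length_le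
          simp only [List.length_append, List.length_singleton] at h₂
          omega
        simpa [played, ho] using (hf' l hnot v hv).2 w hpre hw.vertexStep
    intro ρ l h
    induction h with
    | start => exact fun _ => Consistent.start
    | keep ρ l v w _ hv hw _ ih => exact aux ih hv hw
    | drop ρ l v w _ hv hw _ ih => exact aux ih hv hw
  exact ⟨τ', hcons hκ List.prefix_rfl, fun s => hf _ s rfl⟩

/-- At every vertex with a chosen history, `σ'` plays what `σ` plays after this history. -/
def HistoryChoice.Follows {σ : A.Strategy t NZPlayer.eve} (H : HistoryChoice σ)
    (σ' : A.Strategy t NZPlayer.eve) : Prop :=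
  ∀ (π : List (NZVertex Q)) (v : NZVertex Q), π.getLast? = some v → v ∈ H.domain →
    A.owner v.state = NZPlayer.eve → σ'.move π = σ.move (H.hist v)

namespace HistoryChoice

variable {σ : A.Strategy t NZPlayer.eve} (H : HistoryChoice σ)

theorem exists_positional (hHC : A.Complete) :
    ∃ σ' : A.Strategy t NZPlayer.eve, σ'.Positional ∧ H.Follows σ' := by
  classical
  have hex : ∀ v : NZVertex Q, ∃ m : NZMove Q, (A.owner v.state = NZPlayer.eve →
      m ∈ A.trans v.state (t v.node)) ∧
      (v ∈ H.domain → A.owner v.state = NZPlayer.eve → m = σ.move (H.hist v)) := by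
    intro v
    by_cases hv : v ∈ H.domain
    · exact ⟨σ.move (H.hist v), σ.legal _ _ (H.getLast?_hist v hv), fun _ _ => rfl⟩
    · obtain ⟨m, hm⟩ := hHC v.state (t v.node)
      exact ⟨m, fun _ => hm, fun h => (hv h).elim⟩
  choose f hf hf' using hex
  -- The default `σ.move []` is used only for the empty sequence, where legality imposes nothing.
  refine ⟨⟨fun π => (π.getLast?.map f).getD (σ.move []), fun π v hv ho => ?_⟩,
    fun π π' v hv hv' _ => ?_, fun π v hv hvd ho => ?_⟩
  · simpa [hv] using hf v ho
  · simp [hv, hv']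
  · simpa [hv] using hf' v hvd ho

variable {H} {σ' : A.Strategy t NZPlayer.eve} {τ : A.Strategy t NZPlayer.adam}

theorem Follows.eveStep (hσ' : H.Follows σ') {π : List (NZVertex Q)} {v w : NZVertex Q}
    (hv : π.getLast? = some v) (hvd : v ∈ H.domain)
    (hw : w ∈ (played σ' τ π v).succs v.node) : EveStep σ (H.hist v) v w := by
  cases ho : A.owner v.state with
  | eve =>
    simp only [played, ho] at hw
    refine ⟨_, σ'.legal π v hv ho, fun _ => hσ' π v hv hvd ho, hw⟩
  | adam =>
    simp only [played, ho] at hw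
    exact ⟨_, τ.legal π v hv ho, fun h => by simp [ho] at h, hw⟩

theorem Follows.mem_domain (hσ' : H.Follows σ') {π : List (NZVertex Q)}
    (h : Consistent σ' τ π) {v : NZVertex Q} (hv : π.getLast? = some v) : v ∈ H.domain := by
  induction h generalizing v with
  | start =>
    obtain rfl : A.start = v := by simpa using hv
    exact H.start_mem
  | step π u w _ hu hw ih =>
    obtain rfl : w = v := by simpa using hv
    exact H.mem_of_step u (ih hu) w (hσ'.eveStep hu (ih hu) hw)

theorem Follows.eveStep_of_consistent (hσ' : H.Follows σ') {π : List (NZVertex Q)}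
    {v w : NZVertex Q} (h : Consistent σ' τ (π ++ [w])) (hv : π.getLast? = some v) :
    v ∈ H.domain ∧ EveStep σ (H.hist v) v w := by
  obtain ⟨hπ, hw⟩ := h.of_concat hv
  have hvd := hσ'.mem_domain hπ hv
  exact ⟨hvd, hσ'.eveStep hv hvd hw⟩

/-- The link between the two games: Eve's moves agree because the chosen history is the actual play
of `σ`, Adam's by imitation. -/
theorem Follows.played_eq (hσ' : H.Follows σ') {τ' : A.Strategy t NZPlayer.adam}
    {π κ : List (NZVertex Q)} {u : NZVertex Q} (hu : π.getLast? = some u) (hud : u ∈ H.domain)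
    (hκ : H.hist u = κ) (hτ' : τ'.move κ = τ.move π) :
    played σ τ' κ u = played σ' τ π u := by
  cases ho : A.owner u.state with
  | eve => simp only [played, ho, hσ' π u hu hud ho, hκ]
  | adam => simp only [played, ho, hτ']

/-- As long as the level does not change, the chosen histories extend each other. -/
theorem Follows.hist_append (hσ' : H.Follows σ') {π : List (NZVertex Q)} {v : NZVertex Q}
    (hv : π.getLast? = some v) {s : List (NZVertex Q)} (h : Consistent σ' τ (π ++ s))
    (hlevel : ∀ n u, (π ++ s.take n).getLast? = some u → H.level u = H.level v)
    {u : NZVertex Q} (hu : (π ++ s).getLast? = some u) : H.hist u = H.hist v ++ s := by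
  induction s using List.reverseRecOn generalizing u with
  | nil =>
    obtain rfl : v = u := by simpa [hv] using hu
    simp
  | append_singleton s w ih =>
    obtain rfl : w = u := by simpa using hu
    have hne : π ++ s ≠ [] := by
      intro h'
      simp [(List.append_eq_nil_iff.1 h').1] at hv
    rw [← List.append_assoc] at h
    have hx := List.getLast?_eq_some_getLast hne
    obtain ⟨hxd, hstep⟩ := hσ'.eveStep_of_consistent h hx
    have ih' := ih (h.of_concat hx).1 (fun n u hu' => by
      refine hlevel (min n s.length) u ?_
      rw [List.take_append_of_le_length (Nat.min_le_right _ _)]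
      rcases le_total n s.length with hn | hn
      · rwa [min_eq_left hn]
      · rw [min_eq_right hn, List.take_length]
        rwa [List.take_of_length_le hn] at hu') hx
    have h₁ := hlevel (s.length + 1) w (by rw [List.take_of_length_le (by simp)]; exact hu)
    have h₂ := hlevel s.length _ (by rw [List.take_left']; exacts [hx, rfl])
    rw [H.hist_eq _ hxd w hstep (h₁.trans h₂.symm), ih', List.append_assoc]

theorem Follows.level_append_le (hσ' : H.Follows σ') {π : List (NZVertex Q)} {v : NZVertex Q}
    (hv : π.getLast? = some v) {s : List (NZVertex Q)} (h : Consistent σ' τ (π ++ s))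
    {u : NZVertex Q} (hu : (π ++ s).getLast? = some u) : H.level u ≤ H.level v := by
  induction s using List.reverseRecOn generalizing u with
  | nil =>
    obtain rfl : v = u := by simpa [hv] using hu
    exact le_rfl
  | append_singleton s w ih =>
    obtain rfl : w = u := by simpa using hu
    have hne : π ++ s ≠ [] := by
      intro h'
      simp [(List.append_eq_nil_iff.1 h').1] at hv
    rw [← List.append_assoc] at h
    have hx := List.getLast?_eq_some_getLast hne
    obtain ⟨hxd, hstep⟩ := hσ'.eveStep_of_consistent h hx
    exact (H.level_le _ hxd w hstep).trans (ih (h.of_concat hx).1 hx)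

theorem getLast?_wordPrefix {V : Type*} (n : ℕ) (ρ : ℕ → V) :
    (wordPrefix (n + 1) ρ).getLast? = some (ρ n) := by
  simp [wordPrefix_succ]

/-- Along a consistent play the chosen histories are eventually the prefixes of one play. -/
theorem Follows.exists_forall_hist_eq (hσ' : H.Follows σ') {ρ : ℕ → NZVertex Q}
    (hρ : ConsistentInf σ' τ ρ) :
    ∃ k, ∀ j, H.hist (ρ (k + j)) = H.hist (ρ k) ++ wordPrefix j (fun i => ρ (k + 1 + i)) := by
  -- At an index where the level is minimal along the play, monotonicity makes it constant from then
  -- on.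
  obtain ⟨_, ⟨k, rfl⟩, hk⟩ := WellFounded.has_min (wellFounded_lt (α := ℕ ×ₗ ℕ))
    (Set.range fun k => H.level (ρ k)) ⟨_, 0, rfl⟩
  have hcat : ∀ j, wordPrefix (k + 1 + j) ρ =
      wordPrefix (k + 1) ρ ++ wordPrefix j (fun i => ρ (k + 1 + i)) := fun j =>
    wordPrefix_add _ _ _
  have hlast : ∀ j, (wordPrefix (k + 1 + j) ρ).getLast? = some (ρ (k + j)) := by
    intro j
    rw [show k + 1 + j = k + j + 1 by omega]
    exact getLast?_wordPrefix _ _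
  have hcons : ∀ j, Consistent σ' τ (wordPrefix (k + 1 + j) ρ) := by
    intro j
    rw [show k + 1 + j = k + j + 1 by omega]
    exact hρ (k + j)
  refine ⟨k, fun j => ?_⟩
  refine hσ'.hist_append (getLast?_wordPrefix k ρ) (hcat j ▸ hcons j) (fun n u hu => ?_)
    (hcat j ▸ hlast j)
  have hmin : ∃ i, u = ρ (k + i) := by
    refine ⟨min n j, ?_⟩
    have htake : (wordPrefix j fun i => ρ (k + 1 + i)).take n =
        wordPrefix (min n j) fun i => ρ (k + 1 + i) := by
      rcases le_total n j with h | h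
      · rw [take_wordPrefix h, min_eq_left h]
      · rw [min_eq_right h, List.take_of_length_le (by rwa [length_wordPrefix])]
    rw [htake, ← hcat, hlast] at hu
    simpa using hu.symm
  obtain ⟨i, rfl⟩ := hmin
  refine le_antisymm ?_ (not_lt.1 (hk _ ⟨k + i, rfl⟩))
  exact hσ'.level_append_le (getLast?_wordPrefix k ρ) (hcat i ▸ hcons i) (hcat i ▸ hlast i)

end HistoryChoice

theorem limsupIn_shift_iff [LinearOrder Q] (k : ℕ) {ρ : ℕ → NZVertex Q} {F : Set Q} :
    LimsupIn (fun i => ρ (k + i)) F ↔ LimsupIn ρ F := by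
  have : ∀ r, (∃ᶠ i in Filter.atTop, (ρ (k + i)).state = r) ↔
      ∃ᶠ i in Filter.atTop, (ρ i).state = r := by
    intro r
    conv_rhs => rw [← Filter.map_add_atTop_eq_nat k, Filter.frequently_map]
    simp only [add_comm]
  simp only [LimsupIn, this]

theorem measurableSet_limsupIn [LinearOrder Q] [Countable Q] (F : Set Q) :
    MeasurableSet {ρ : ℕ → NZVertex Q | LimsupIn ρ F} := by
  have hstate : ∀ (n : ℕ) (r : Q), MeasurableSet {ρ : ℕ → NZVertex Q | (ρ n).state = r} :=
    fun n r => measurable_pi_apply (X := fun _ : ℕ => NZVertex Q) n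
      (MeasurableSet.of_discrete (s := {v : NZVertex Q | v.state = r}))
  have hfreq : ∀ r : Q, MeasurableSet
      {ρ : ℕ → NZVertex Q | ∃ᶠ n in Filter.atTop, (ρ n).state = r} := by
    intro r
    simp only [Filter.frequently_atTop]
    simp only [Set.ofPred_forall, Set.ofPred_exists, Set.ofPred_and]
    exact MeasurableSet.iInter fun a => MeasurableSet.iUnion fun b =>
      (MeasurableSet.const _).inter (hstate b r)
  have heq : {ρ : ℕ → NZVertex Q | LimsupIn ρ F} = ⋃ q ∈ F,
      {ρ : ℕ → NZVertex Q | ∃ᶠ n in Filter.atTop, (ρ n).state = q} ∩ ⋂ (r : Q), ⋂ (_ : ¬ r ≤ q),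
        {ρ : ℕ → NZVertex Q | ∃ᶠ n in Filter.atTop, (ρ n).state = r}ᶜ := by
    ext ρ
    simp only [LimsupIn, IsGreatest, upperBounds, Set.mem_ofPred_eq, Set.mem_iUnion,
      Set.mem_inter_iff, Set.mem_iInter, Set.mem_compl_iff, exists_prop]
    refine exists_congr fun q => and_congr_right fun _ => and_congr_right fun _ => ?_
    exact ⟨fun h r hr hr' => hr (h hr'), fun h r hr => not_not.1 fun h' => h r h' hr⟩
  rw [heq]
  exact MeasurableSet.biUnion (Set.to_countable F) fun q _ => (hfreq q).inter
    (MeasurableSet.iInter fun r => MeasurableSet.iInter fun _ => (hfreq r).compl)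

end Plays

/-! ### Transfer of the three winning conditions from `σ`. -/

section Transfer

open MeasureTheory

variable {S Q : Type*} {A : NZAutomaton S Q} {t : List Bool → S}

theorem playMeasure_wordCylinder_eq_zero_of_append [Countable Q] {σ : A.Strategy t NZPlayer.eve}
    {τ : A.Strategy t NZPlayer.adam} {π s : List (NZVertex Q)} (hπ : Consistent σ τ π)
    (h : ¬ Consistent σ τ (π ++ s)) : playMeasure σ τ (wordCylinder (π ++ s)) = 0 := by
  induction s using List.reverseRecOn with
  | nil => exact (h (by simpa using hπ)).elim
  | append_singleton s w ih =>
    rw [← List.append_assoc] at h ⊢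
    by_cases hs : Consistent σ τ (π ++ s)
    · exact playMeasure_wordCylinder_append_eq_zero hs h
    · exact measure_mono_null (fun ρ hρ => (mem_wordCylinder_append.1 hρ).1) (ih hs)

theorem Consistent.ne_nil {σ : A.Strategy t NZPlayer.eve} {τ : A.Strategy t NZPlayer.adam}
    {π : List (NZVertex Q)} (h : Consistent σ τ π) : π ≠ [] := by
  cases h <;> simp

namespace HistoryChoice

variable {σ : A.Strategy t NZPlayer.eve} {H : HistoryChoice σ}
  {σ' : A.Strategy t NZPlayer.eve} {τ : A.Strategy t NZPlayer.adam}

/-- On a set of continuations along which the chosen histories extend each other, the strategy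
`σ'` after `π` and the strategy `σ` after the history chosen for the last vertex of `π` have the
same null sets, if Adam imitates in the second play what he does in the first one. -/
theorem Follows.exists_measure_eq_zero_iff [Countable Q] (hσ' : H.Follows σ') (hHC : A.Complete)
    {π : List (NZVertex Q)} {v : NZVertex Q} (hπ : Consistent σ' τ π)
    (hv : π.getLast? = some v) {G : Set (List (NZVertex Q))} (hG : ∀ s ∈ G, ∀ n, s.take n ∈ G)
    (hhist : ∀ s ∈ G, Consistent σ' τ (π ++ s) → ∀ u, (π ++ s).getLast? = some u →
      H.hist u = H.hist v ++ s)
    {E : Set (ℕ → NZVertex Q)} (hE : MeasurableSet E)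
    (hEG : ∀ ρ ∈ E, ∀ n, wordPrefix n ρ ∈ G) :
    ∃ τ' : A.Strategy t NZPlayer.adam, Consistent σ τ' (H.hist v) ∧
      (playMeasure σ' τ (wordCylinder π ∩ {ρ | (fun i => ρ (π.length + i)) ∈ E}) = 0 ↔
        playMeasure σ τ'
          (wordCylinder (H.hist v) ∩ {ρ | (fun i => ρ ((H.hist v).length + i)) ∈ E}) = 0) := by
  have hvd := hσ'.mem_domain hπ hv
  obtain ⟨θ, hθ⟩ := H.exists_thread v hvd
  have hlast : π.getLast? = (H.hist v).getLast? := by rw [hv, H.getLast?_hist v hvd]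
  obtain ⟨τ', hcons, hτ'⟩ := exists_imitation τ hHC hθ hlast
  refine ⟨τ', hcons, ?_⟩
  -- Cross-multiplying by the probability of the other prefix compares the conditional laws without
  -- division; both weights are nonzero.
  set a := playMeasure σ τ' (wordCylinder (H.hist v)) with ha
  set b := playMeasure σ' τ (wordCylinder π) with hb
  have ha0 : a ≠ 0 := playMeasure_wordCylinder_ne_zero hcons
  have hb0 : b ≠ 0 := playMeasure_wordCylinder_ne_zero hπ
  have hcyl : ∀ s ∈ G, a * playMeasure σ' τ (wordCylinder (π ++ s)) =
      b * playMeasure σ τ' (wordCylinder (H.hist v ++ s)) := by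
    intro s hs
    induction s using List.reverseRecOn with
    | nil => rw [List.append_nil, List.append_nil, ← ha, ← hb, mul_comm]
    | append_singleton s w ih =>
      have hsG : s ∈ G := by
        have := hG _ hs s.length
        rwa [List.take_left' rfl] at this
      have ih' := ih hsG
      have hne : π ++ s ≠ [] := by simp [hπ.ne_nil]
      have hu := List.getLast?_eq_some_getLast hne
      have hu' := (getLast?_append_of_eq hlast s).symm.trans hu
      rw [← List.append_assoc, ← List.append_assoc, playMeasure_wordCylinder_append _ _ hu,
        playMeasure_wordCylinder_append _ _ hu', ← mul_assoc, ← mul_assoc, ih']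
      -- After an inconsistent word nothing is known about the histories, but both sides already
      -- vanish.
      by_cases hc : Consistent σ' τ (π ++ s)
      · rw [hσ'.played_eq hu (hσ'.mem_domain hc hu) (hhist s hsG hc _ hu) (hτ' s)]
      · rw [playMeasure_wordCylinder_eq_zero_of_append hπ hc, mul_zero] at ih'
        rw [← ih', zero_mul, zero_mul]
  have := measure_continuations_eq hG (measure_ne_top _ _) (measure_ne_top _ _) hcyl hE hEG
  constructor
  · intro h
    rw [h, mul_zero, zero_eq_mul] at this
    exact this.resolve_left hb0
  · intro h
    rw [h, mul_zero, mul_eq_zero] at this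
    exact this.resolve_left ha0

theorem Follows.limsupIn_Fall [Countable Q] [LinearOrder Q] (hσ' : H.Follows σ')
    (hHC : A.Complete) (hσ : Winning σ) {ρ : ℕ → NZVertex Q} (hρ : ConsistentInf σ' τ ρ) :
    LimsupIn ρ A.Fall := by
  obtain ⟨k, hk⟩ := hσ'.exists_forall_hist_eq hρ
  set r : ℕ → NZVertex Q := fun i => ρ (k + 1 + i)
  set κ := H.hist (ρ k) with hκ
  have hlastk : (wordPrefix (k + 1) ρ).getLast? = some (ρ k) := getLast?_wordPrefix k ρ
  have hd : ∀ j, ρ j ∈ H.domain := fun j => hσ'.mem_domain (hρ j) (getLast?_wordPrefix j ρ)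
  obtain ⟨θ, hθ⟩ := H.exists_thread _ (hd k)
  have hlast : (wordPrefix (k + 1) ρ).getLast? = κ.getLast? := by
    rw [hlastk, hκ, H.getLast?_hist _ (hd k)]
  obtain ⟨τ', hcons, hτ'⟩ := exists_imitation τ hHC hθ hlast
  have hcat : ∀ j, wordPrefix (k + j + 1) ρ = wordPrefix (k + 1) ρ ++ wordPrefix j r := fun j => by
    rw [show k + j + 1 = k + 1 + j by omega]
    exact wordPrefix_add _ _ _
  have hall : ∀ j, Consistent σ τ' (κ ++ wordPrefix j r) := by
    intro j
    induction j with
    | zero => simpa [wordPrefix] using hcons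
    | succ j ih =>
      have hu : (wordPrefix (k + 1) ρ ++ wordPrefix j r).getLast? = some (ρ (k + j)) := by
        rw [← hcat]
        exact getLast?_wordPrefix _ _
      have hu' := (getLast?_append_of_eq hlast _).symm.trans hu
      rw [wordPrefix_succ, ← List.append_assoc]
      refine ih.step _ _ _ hu' ?_
      rw [hσ'.played_eq hu (hd _) (hk j) (hτ' _)]
      have hstep : Consistent σ' τ (wordPrefix (k + j + 1 + 1) ρ) := hρ (k + j + 1)
      rw [wordPrefix_succ, hcat] at hstep
      have := (hstep.of_concat hu).2
      rwa [show k + j + 1 = k + 1 + j by omega] at this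
  -- The chosen history `κ` followed by the tail of `ρ`: a play consistent with `σ`, with the same
  -- limsup.
  let ρ' : ℕ → NZVertex Q := fun i =>
    if h : i < κ.length then κ[i] else r (i - κ.length)
  have htail : (fun i => ρ' (κ.length + i)) = r := by
    funext i
    simp [ρ']
  have hhead : wordPrefix κ.length ρ' = κ := by
    rw [← mem_wordCylinder_iff]
    intro i hi
    simp [ρ', hi]
  have hρ' : ConsistentInf σ τ' ρ' := by
    intro n
    have h := hall (n + 1)
    have heq : κ ++ wordPrefix (n + 1) r = wordPrefix (κ.length + (n + 1)) ρ' := by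
      rw [wordPrefix_add κ.length, hhead, htail]
    rw [heq, add_comm, wordPrefix_add (n + 1)] at h
    exact h.of_append (by simp [wordPrefix])
  have := (hσ τ').sure ρ' hρ'
  rw [← limsupIn_shift_iff κ.length, htail] at this
  exact (limsupIn_shift_iff (k + 1)).1 this

theorem Follows.ae_limsupIn_Fone [Countable Q] [LinearOrder Q] (hσ' : H.Follows σ')
    (hHC : A.Complete) (hσ : Winning σ) : ∀ᵐ ρ ∂playMeasure σ' τ, LimsupIn ρ A.Fone := by
  -- `G v` collects the words along which the histories extend that of `v`; putting `v` in front
  -- supplies the last vertex when the word is empty. `E v` is the set of bad continuations that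
  -- stay coherent.
  let G : NZVertex Q → Set (List (NZVertex Q)) := fun v =>
    {s | ∀ n u, (v :: s.take n).getLast? = some u → H.hist u = H.hist v ++ s.take n}
  let E : NZVertex Q → Set (ℕ → NZVertex Q) := fun v =>
    (⋂ n, {ρ | wordPrefix n ρ ∈ G v}) ∩ {ρ | LimsupIn ρ A.Fone}ᶜ
  have hE : ∀ v, MeasurableSet (E v) := fun v =>
    (MeasurableSet.iInter fun n => measurableSet_wordPrefix_mem n (G v)).inter
      (measurableSet_limsupIn _).compl
  -- There are only countably many pairs `(π, v)`, so a null set for each suffices.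
  have hnull : ∀ᵐ ρ ∂playMeasure σ' τ, ∀ (π : List (NZVertex Q)) (v : NZVertex Q),
      Consistent σ' τ π → π.getLast? = some v →
        ρ ∉ wordCylinder π ∩ {ρ | (fun i => ρ (π.length + i)) ∈ E v} := by
    rw [ae_all_iff]
    intro π
    rw [ae_all_iff]
    intro v
    by_cases hπ : Consistent σ' τ π
    · by_cases hv : π.getLast? = some v
      · obtain ⟨τ', -, hiff⟩ := hσ'.exists_measure_eq_zero_iff hHC hπ hv (G := G v) (E := E v)
          (fun s hs n m u hu => by
            rw [List.take_take] at hu ⊢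
            exact hs _ u hu)
          (fun s hs _ u hu => by
            have hlast : π.getLast? = [v].getLast? := by simpa using hv
            have := hs s.length u
            rw [List.take_length] at this
            exact this ((getLast?_append_of_eq hlast s).symm.trans hu))
          (hE v) (fun ρ hρ n => Set.mem_iInter.1 hρ.1 n)
        have hz : playMeasure σ τ' (wordCylinder (H.hist v) ∩
            {ρ | (fun i => ρ ((H.hist v).length + i)) ∈ E v}) = 0 := by
          refine measure_mono_null (fun ρ hρ => ?_) (hσ τ').almostSure
          exact fun h => hρ.2.2 ((limsupIn_shift_iff _).2 h)
        filter_upwards [measure_eq_zero_iff_ae_notMem.1 (hiff.2 hz)] with ρ hρ _ _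
        exact hρ
      · simp [hv]
    · simp [hπ]
  filter_upwards [hnull, ae_consistentInf σ' τ] with ρ hρ hcons
  obtain ⟨k, hk⟩ := hσ'.exists_forall_hist_eq hcons
  by_contra hlim
  refine hρ (wordPrefix (k + 1) ρ) (ρ k) (hcons k) (getLast?_wordPrefix k ρ) ⟨?_, ?_⟩
  · rw [mem_wordCylinder_iff, length_wordPrefix]
  · rw [length_wordPrefix]
    refine ⟨Set.mem_iInter.2 fun n m u hu => ?_, fun h => hlim ((limsupIn_shift_iff _).1 h)⟩
    obtain ⟨j, hj⟩ : ∃ j, (wordPrefix n fun i => ρ (k + 1 + i)).take m =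
        wordPrefix j fun i => ρ (k + 1 + i) := by
      rcases le_total m n with h | h
      · exact ⟨m, take_wordPrefix h _⟩
      · exact ⟨n, List.take_of_length_le (by rwa [length_wordPrefix])⟩
    rw [hj] at hu ⊢
    have huj : u = ρ (k + j) := by
      cases j with
      | zero => simpa [wordPrefix] using hu.symm
      | succ j =>
        rw [wordPrefix_succ, ← List.cons_append, List.getLast?_concat] at hu
        rw [show k + (j + 1) = k + 1 + j by omega]
        simpa using hu.symm
    rw [huj]
    exact hk j

theorem positiveContinuations_eq (A : NZAutomaton S Q) (π : List (NZVertex Q)) :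
    A.positiveContinuations π = wordCylinder π ∩
      {ρ | (fun i => ρ (π.length + i)) ∈ {ρ : ℕ → NZVertex Q | ∀ i, (ρ i).state ∈ A.Fpos}} := by
  ext ρ
  refine and_congr_right fun _ => ⟨fun h i => h _ (Nat.le_add_right _ _), fun h i hi => ?_⟩
  have : (ρ (π.length + (i - π.length))).state ∈ A.Fpos := h (i - π.length)
  rwa [Nat.add_sub_cancel' hi] at this

theorem Follows.measure_positiveContinuations_ne_zero [Countable Q] [LinearOrder Q]
    (hσ' : H.Follows σ') (hHC : A.Complete) (hσ : Winning σ) {π : List (NZVertex Q)}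
    {v : NZVertex Q} (hπ : Consistent σ' τ π) (hv : π.getLast? = some v)
    (hvF : v.state ∈ A.Fpos) : playMeasure σ' τ (A.positiveContinuations π) ≠ 0 := by
  have hmeas : MeasurableSet {ρ : ℕ → NZVertex Q | ∀ i, (ρ i).state ∈ A.Fpos} := by
    rw [Set.ofPred_forall]
    exact MeasurableSet.iInter fun n => measurable_pi_apply (X := fun _ : ℕ => NZVertex Q) n
      (MeasurableSet.of_discrete (s := {v : NZVertex Q | v.state ∈ A.Fpos}))
  -- Among the finite consistent continuations inside `F_{>0}`, take one whose last vertex has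
  -- minimal level. Its positive continuations are also positive continuations of `π`, and
  -- minimality forbids any further drop of level along them.
  obtain ⟨_, ⟨s, v', ⟨hs, hcons, hv'⟩, rfl⟩, hmin⟩ :=
    WellFounded.has_min (wellFounded_lt (α := ℕ ×ₗ ℕ))
      {l | ∃ (s : List (NZVertex Q)) (u : NZVertex Q), ((∀ w ∈ s, w.state ∈ A.Fpos) ∧
        Consistent σ' τ (π ++ s) ∧ (π ++ s).getLast? = some u) ∧ H.level u = l}
      ⟨_, [], v, ⟨by simp, by simpa using hπ, by simpa using hv⟩, rfl⟩
  have hsub : A.positiveContinuations (π ++ s) ⊆ A.positiveContinuations π := by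
    rintro ρ ⟨h₁, h₂⟩
    refine ⟨(mem_wordCylinder_append.1 h₁).1, fun i hi => ?_⟩
    by_cases hi' : i < (π ++ s).length
    · rw [h₁ i hi', List.getElem_append_right hi]
      exact hs _ (List.getElem_mem _)
    · exact h₂ i (not_lt.1 hi')
  refine fun h => ?_
  replace h := measure_mono_null hsub h
  have hv'F : v'.state ∈ A.Fpos := by
    rw [List.getLast?_append, Option.or_eq_some_iff] at hv'
    rcases hv' with h' | ⟨-, h'⟩
    · exact hs _ (List.mem_of_getLast? h')
    · obtain rfl : v = v' := by simpa [hv] using h'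
      exact hvF
  obtain ⟨τ', hcons', hiff⟩ := hσ'.exists_measure_eq_zero_iff hHC hcons hv'
    (G := {s' | ∀ w ∈ s', w.state ∈ A.Fpos})
    (fun s' hs' n w hw => hs' w (List.mem_of_mem_take hw))
    (fun s' hs' hc u hu => by
      refine hσ'.hist_append hv' hc (fun n u' hu' => ?_) hu
      have hcn : Consistent σ' τ (π ++ s ++ s'.take n) := by
        rw [← List.take_append_drop n s', ← List.append_assoc] at hc
        refine hc.of_append fun h' => hcons.ne_nil (List.append_eq_nil_iff.1 h').1
      refine le_antisymm (hσ'.level_append_le hv' hcn hu') (not_lt.1 (hmin _ ?_))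
      refine ⟨s ++ s'.take n, u', ⟨fun w hw => ?_, by rwa [← List.append_assoc],
        by rwa [← List.append_assoc]⟩, rfl⟩
      rcases List.mem_append.1 hw with hw | hw
      · exact hs w hw
      · exact hs' w (List.mem_of_mem_take hw))
    hmeas (fun ρ hρ n w hw => by
      obtain ⟨i, rfl⟩ := (List.mem_ofFn' _ _).1 hw
      exact hρ _)
  rw [← positiveContinuations_eq, ← positiveContinuations_eq] at hiff
  exact (hσ τ').positive _ v' hcons' (H.getLast?_hist _ (hσ'.mem_domain hcons hv')) hv'F
    (hiff.1 h)

end HistoryChoice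

end Transfer

end NZAutomaton

theorem mainTheorem6 {S Q : Type*} [Finite S] [Finite Q] [LinearOrder Q]
    (A : NZAutomaton S Q) (hHC : A.Complete) (hLC : A.LimitedChoice) (hNLL : A.NoLocalLoop)
    (t : List Bool → S)
    (hwin : ∃ σ : A.Strategy t NZPlayer.eve, NZAutomaton.Winning σ) :
    ∃ σ : A.Strategy t NZPlayer.eve, σ.Positional ∧ NZAutomaton.Winning σ := by
  obtain ⟨σ, hσ⟩ := hwin
  obtain ⟨H⟩ := NZAutomaton.nonempty_historyChoice hLC hNLL σ
  obtain ⟨σ', hpos, hσ'⟩ := H.exists_positional hHC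
  exact ⟨σ', hpos, fun τ => ⟨fun ρ hρ => hσ'.limsupIn_Fall hHC hσ hρ,
    hσ'.ae_limsupIn_Fone hHC hσ,
    fun π v hπ hv hvF => hσ'.measure_positiveContinuations_ne_zero hHC hσ hπ hv hvF⟩⟩
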